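/- Let $\zeta_{24}=e^{2\pi i/24}$, $T=\begin{pmatrix}1&1\\0&1\end{pmatrix}$, $R=\begin{pmatrix}1&0\\2&1\end{pmatrix}$, and let $\chi:\Gamma_0(2)\to\mathbb{S}^1$ be the multiplier system (a group homomorphism) defined on the generators $T,R$ of $\Gamma_0(2)$ by $\chi(T)=\chi(R)=\zeta_{24}$. Say that a function $h$, defined on $\mathbb{Q}$ with the possible exception of finitely many points, extends smoothly to $\mathbb{R}$ except at finitely many points if there are a finite set $S\subset\mathbb{Q}$ and a function $H:\mathbb{R}\to\mathbb{C}$ that is $C^\infty$ on $\mathbb{R}\setminus S$ such that $H(x)=h(x)$ for all $x\in\mathbb{Q}\setminus S$. For a multiplier system $\psi:\Gamma_0(2)\to\mathbb{S}^1$, a function $f:\mathbb{Q}\to\mathbb{C}$ is called a quantum modular form of weight $1$ on $\Gamma_0(2)$ with multiplier system $\psi$ if, for every $\gamma=\begin{pmatrix}a&b\\c&d\end{pmatrix}\in\Gamma_0(2)$, the function $$h_\gamma(x)=f(x)-\psi(\gamma)^{-1}|cx+d|^{-1}f\left(\frac{ax+b}{cx+d}\right)$$ extends smoothly to $\mathbb{R}$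 except at finitely many points. Let $f:\mathbb{Q}\to\mathbb{C}$ be a quantum modular form of weight $1$ on $\Gamma_0(2)$ with multiplier system $\chi$. For a prime $p$ with $5\le p\le 757$, define $T_p^\infty f:\mathbb{Q}\to\mathbb{C}$ by $$T_p^\infty f(x)=(-1)^{\frac{p^2-1}{24}}f(px)+\frac1p\sum_{j=0}^{p-1}\zeta_{24}^{-pj}f\left(\frac{x+j}{p}\right).$$ Then $g=T_p^\infty f$ is a quantum modular form of weight $1$ on $\Gamma_0(2)$ with multiplier system $\chi^p$. Moreover, if $f(x+1)=\zeta_{24}f(x)$ for all $x\in\mathbb{Q}$, then $$g(x+1)=\zeta_{24}^{p}\,g(x)\quad(x\in\mathbb{Q}),\qquad \frac1{|2x+1|}\,g\left(\frac{x}{2x+1}\right)=\zeta_{24}^{p}\,g(x)+H(x),$$ where $H$ extends smoothly to $\mathbb{R}$ except at finitely many points. -/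

import Mathlib

open scoped MatrixGroups ContDiff

namespace QuantumModular

open CongruenceSubgroup

/-- A function `h` on `ℚ` can be extended smoothly to `ℝ` except at finitely many points of `ℚ`:
there are a finite set `S ⊂ ℚ` and a function on `ℝ`, of class `C^∞` on `ℝ \ S`,
that agrees with `h` on `ℚ \ S`. -/
def ExtendsSmoothly (h : ℚ → ℂ) : Prop :=
  ∃ (S : Finset ℚ) (H : ℝ → ℂ),
    ContDiffOn ℝ ∞ H ((fun q : ℚ => (q : ℝ)) '' (S : Set ℚ))ᶜ ∧
      ∀ x : ℚ, x ∉ S → H (x : ℝ) = h x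

/-- The weight `k` slash action with multiplier system `χ`, for `γ = (a, b; c, d)`:
`(f|γ)(x) = χ(γ)⁻¹ |cx+d|^(-k) f((ax+b)/(cx+d))`.
At the single point `x = -d/c` (for `c ≠ 0`) the value has no meaning; it is never used,
because the relation in `IsQuantumModularForm` may leave out finitely many rational points. -/
noncomputable def slash {N : ℕ} (k : ℤ) (χ : Gamma0 N →* Circle) (f : ℚ → ℂ) (γ : Gamma0 N) :
    ℚ → ℂ := fun x =>
  let a : ℚ := ((γ : SL(2, ℤ)) 0 0 : ℤ)
  let b : ℚ := ((γ : SL(2, ℤ)) 0 1 : ℤ)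
  let c : ℚ := ((γ : SL(2, ℤ)) 1 0 : ℤ)
  let d : ℚ := ((γ : SL(2, ℤ)) 1 1 : ℤ)
  (χ γ : ℂ)⁻¹ * ((|c * x + d| : ℚ) : ℂ) ^ (-k) * f ((a * x + b) / (c * x + d))

/-- `f : ℚ → ℂ` is a quantum modular form of weight `k` on `Γ₀(N)` with multiplier system `χ`. -/
def IsQuantumModularForm (N : ℕ) (k : ℤ) (χ : Gamma0 N →* Circle) (f : ℚ → ℂ) : Prop :=
  ∀ γ : Gamma0 N, ExtendsSmoothly (fun x => f x - slash k χ f γ x)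

/-- The matrix `(1, 1; 0, 1)`. -/
def matT : SL(2, ℤ) := ⟨!![1, 1; 0, 1], by simp [Matrix.det_fin_two]⟩

/-- The matrix `(1, 0; 2, 1)`. -/
def matR : SL(2, ℤ) := ⟨!![1, 0; 2, 1], by simp [Matrix.det_fin_two]⟩

/-- The generator `T = (1, 1; 0, 1)` of `Γ₀(2)`. -/
def T : Gamma0 2 := ⟨matT, Gamma0_mem.mpr (by simp [matT])⟩

/-- The generator `R = (1, 0; 2, 1)` of `Γ₀(2)`. -/
def R : Gamma0 2 := ⟨matR, Gamma0_mem.mpr (by simp [matR]; decide)⟩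

/-- `ζ₂₄ = e^{2πi/24}`. -/
noncomputable def zeta24 : ℂ := Complex.exp (2 * Real.pi * Complex.I / 24)

/-- The operator `T_p^∞`. The exponent `(p² - 1)/24` is an exact quotient for every prime `p ≥ 5`. -/
noncomputable def hecke (p : ℕ) (f : ℚ → ℂ) : ℚ → ℂ := fun x =>
  (-1 : ℂ) ^ ((p ^ 2 - 1) / 24) * f ((p : ℚ) * x) +
    (1 / (p : ℂ)) * ∑ j ∈ Finset.range p,
      zeta24 ^ (-((p : ℤ) * (j : ℤ))) * f ((x + (j : ℚ)) / (p : ℚ))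

end QuantumModular

/-!
Write `f|M (x) = |cx+d|⁻¹ f((ax+b)/(cx+d))` for an integer matrix `M = (a, b; c, d)` with nonzero
determinant. Away from finitely many points this is a right action, and it preserves functions that
extend smoothly (`act_mul`, `ExtendsSmoothly.act`). Hence the matrices at which a function satisfies
the modular relation form a group (`relationSubgroup`), and the modularity of `T_p^∞ f` has to be
checked only at the generators `T` and `R` of `Γ₀(2)` (`gamma0_two_induction`).

The operator is a sum `∑ wᵢ f|Aᵢ` over representatives `Aᵢ` of the cosets of integer matrices of
determinant `p`, indexed by the projective line over `ZMod p` (`hecke_eq_sum`). For `B = T` or `R`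
one has `Aᵢ B = γᵢ A_{σ i}` with `γᵢ ∈ Γ₀(2)` and a permutation `σ`, so that `f|Aᵢ B` equals
`χ(γᵢ) f|A_{σ i}` up to a function that extends smoothly. The claim becomes
`wᵢ χ(B)⁻ᵖ χ(γᵢ) = w_{σ i}` (`mem_relationSubgroup_hecke`).

This needs `χ` on the matrices `γᵢ`. As `χ` is the multiplier system of `η(2τ)/η(τ)`, it has a closed
form `χ(γ) = e^{2πiΦ(γ)/48}` with an integer polynomial `Φ` in the entries of `γ` (`phase`,
`multiplier_eq`). That form is proved here by showing that `Φ` grows by `2` modulo `48` under right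
multiplication by `T` and by `R`. The conditions on `wᵢ` are then congruences modulo `48`, and they
follow from `p² ≡ 1` modulo `24`.
-/

open scoped MatrixGroups ContDiff

namespace QuantumModular

open CongruenceSubgroup Filter

/-! ### Functions that extend smoothly -/

theorem ExtendsSmoothly.congr {h h' : ℚ → ℂ} (hh : ExtendsSmoothly h)
    (e : h =ᶠ[cofinite] h') : ExtendsSmoothly h' := by
  classical
  obtain ⟨S, H, hH, hS⟩ := hh
  have hfin : {x | h x ≠ h' x}.Finite := e
  refine ⟨S ∪ hfin.toFinset, H, hH.mono ?_, fun x hx => ?_⟩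
  · apply Set.compl_subset_compl.mpr
    apply Set.image_mono
    simp
  · simp only [Finset.mem_union, Set.Finite.mem_toFinset, Set.mem_ofPred_eq, not_or, not_not] at hx
    rw [hS x hx.1, hx.2]

theorem ExtendsSmoothly.zero : ExtendsSmoothly (fun _ => 0) :=
  ⟨∅, fun _ => 0, contDiffOn_const, fun _ _ => rfl⟩

theorem ExtendsSmoothly.add {h h' : ℚ → ℂ} (hh : ExtendsSmoothly h) (hh' : ExtendsSmoothly h') :
    ExtendsSmoothly (fun x => h x + h' x) := by
  classical
  obtain ⟨S, H, hH, hS⟩ := hh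
  obtain ⟨S', H', hH', hS'⟩ := hh'
  refine ⟨S ∪ S', fun x => H x + H' x, (hH.mono ?_).add (hH'.mono ?_), fun x hx => ?_⟩
  · exact Set.compl_subset_compl.mpr (Set.image_mono (by simp))
  · exact Set.compl_subset_compl.mpr (Set.image_mono (by simp))
  · simp only [Finset.mem_union, not_or] at hx
    simp only [hS x hx.1, hS' x hx.2]

theorem ExtendsSmoothly.const_mul {h : ℚ → ℂ} (u : ℂ) (hh : ExtendsSmoothly h) :
    ExtendsSmoothly (fun x => u * h x) := by
  obtain ⟨S, H, hH, hS⟩ := hh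
  exact ⟨S, fun x => u * H x, contDiffOn_const.mul hH, fun x hx => by simp only [hS x hx]⟩

theorem ExtendsSmoothly.sum {ι : Type*} (s : Finset ι) {h : ι → ℚ → ℂ}
    (hh : ∀ i ∈ s, ExtendsSmoothly (h i)) : ExtendsSmoothly (fun x => ∑ i ∈ s, h i x) := by
  classical
  induction s using Finset.induction_on with
  | empty => simpa using ExtendsSmoothly.zero
  | insert i s hi ih =>
    simp only [Finset.sum_insert hi]
    exact (hh i (by simp)).add (ih fun j hj => hh j (by simp [hj]))

/-! ### The weight one action of integer matrices -/

/-- The weight `1` action without multiplier of an integer matrix `(a, b; c, d)`: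
`f ↦ |cx+d|⁻¹ f((ax+b)/(cx+d))`. No power of the determinant is included. -/
noncomputable def act (M : Matrix (Fin 2) (Fin 2) ℤ) (f : ℚ → ℂ) : ℚ → ℂ := fun x =>
  ((|(M 1 0 : ℚ) * x + M 1 1| : ℚ) : ℂ)⁻¹ *
    f (((M 0 0 : ℚ) * x + M 0 1) / ((M 1 0 : ℚ) * x + M 1 1))

theorem slash_one_eq {N : ℕ} (χ : Gamma0 N →* Circle) (f : ℚ → ℂ) (γ : Gamma0 N) (x : ℚ) :
    slash 1 χ f γ x = (χ γ : ℂ)⁻¹ * act (γ : SL(2, ℤ)).1 f x := by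
  simp only [slash, act, zpow_neg_one, mul_assoc]

theorem eventually_denom_ne_zero {B : Matrix (Fin 2) (Fin 2) ℤ} (hB : B.det ≠ 0) :
    ∀ᶠ x : ℚ in cofinite, (B 1 0 : ℚ) * x + B 1 1 ≠ 0 := by
  refine Set.Finite.subset (Set.finite_singleton (-(B 1 1 : ℚ) / B 1 0)) fun x hx => ?_
  simp only [ne_eq, Set.mem_compl_iff, Set.mem_ofPred_eq, not_not] at hx
  by_cases hc : (B 1 0 : ℚ) = 0
  · rw [hc, zero_mul, zero_add] at hx
    rw [Matrix.det_fin_two] at hB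
    simp_all
  · rw [Set.mem_singleton_iff, eq_div_iff hc]
    linarith

/-- The action is a right action, away from the pole of the inner Möbius transformation. -/
theorem act_mul (A : Matrix (Fin 2) (Fin 2) ℤ) {B : Matrix (Fin 2) (Fin 2) ℤ} (hB : B.det ≠ 0)
    (f : ℚ → ℂ) : act (A * B) f =ᶠ[cofinite] act B (act A f) := by
  filter_upwards [eventually_denom_ne_zero hB] with x hx
  simp only [act, Matrix.mul_apply, Fin.sum_univ_two]
  push_cast
  set e : ℚ := (B 1 0 : ℚ) * x + B 1 1 with he
  have h1 : ((A 1 0 : ℚ) * B 0 0 + A 1 1 * B 1 0) * x + (A 1 0 * B 0 1 + A 1 1 * B 1 1)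
      = ((A 1 0 : ℚ) * ((B 0 0 * x + B 0 1) / e) + A 1 1) * e := by
    field_simp
    rw [he]; ring
  have h2 : ((A 0 0 : ℚ) * B 0 0 + A 0 1 * B 1 0) * x + (A 0 0 * B 0 1 + A 0 1 * B 1 1)
      = ((A 0 0 : ℚ) * ((B 0 0 * x + B 0 1) / e) + A 0 1) * e := by
    field_simp
    rw [he]; ring
  rw [h1, h2, mul_div_mul_right _ _ hx, abs_mul]
  push_cast
  rw [mul_inv]
  ring

/-- The action preserves smooth extendability: the bad set is pulled back along the Möbius
transformation, and its pole is added. -/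
theorem ExtendsSmoothly.act {h : ℚ → ℂ} (hh : ExtendsSmoothly h)
    {M : Matrix (Fin 2) (Fin 2) ℤ} (hM : M.det ≠ 0) : ExtendsSmoothly (act M h) := by
  classical
  obtain ⟨S, H, hH, hS⟩ := hh
  rw [Matrix.det_fin_two] at hM
  obtain ⟨a, ha⟩ : ∃ a, a = M 0 0 := ⟨_, rfl⟩
  obtain ⟨b, hb⟩ : ∃ b, b = M 0 1 := ⟨_, rfl⟩
  obtain ⟨c, hc⟩ : ∃ c, c = M 1 0 := ⟨_, rfl⟩
  obtain ⟨d, hd⟩ : ∃ d, d = M 1 1 := ⟨_, rfl⟩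
  rw [← ha, ← hb, ← hc, ← hd] at hM
  have hMR : (a : ℝ) * d - b * c ≠ 0 := by exact_mod_cast hM
  set S' : Finset ℚ := insert (-(d : ℚ) / c) (S.image fun s => (d * s - b) / (a - c * s)) with hS'
  have key : ∀ x : ℝ, x ∈ ((fun q : ℚ => (q : ℝ)) '' (S' : Set ℚ))ᶜ →
      (c : ℝ) * x + d ≠ 0 ∧
        ((a : ℝ) * x + b) / (c * x + d) ∈ ((fun q : ℚ => (q : ℝ)) '' (S : Set ℚ))ᶜ := by
    intro x hx
    have hden : (c : ℝ) * x + d ≠ 0 := by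
      intro h0
      by_cases hc0 : (c : ℝ) = 0
      · rw [hc0, zero_mul, zero_add] at h0
        rw [hc0, h0] at hMR
        simp at hMR
      · refine hx ⟨-(d : ℚ) / c, by simp [hS'], ?_⟩
        push_cast
        rw [div_eq_iff hc0]
        linarith
    refine ⟨hden, ?_⟩
    rintro ⟨s, hs, hsx⟩
    simp only at hsx
    rw [eq_div_iff hden] at hsx
    refine hx ⟨(d * s - b) / (a - c * s), ?_, ?_⟩
    · rw [hS', Finset.coe_insert, Finset.coe_image]
      exact Or.inr ⟨s, hs, rfl⟩
    · push_cast
      have h1 : (a - c * s : ℝ) * (c * x + d) = a * d - b * c := by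
        linear_combination (-c : ℝ) * hsx
      have h2 : (a - c * s : ℝ) ≠ 0 := by
        intro h0; rw [h0, zero_mul] at h1; exact hMR h1.symm
      rw [div_eq_iff h2]
      linear_combination hsx
  refine ⟨S', fun x => ((|(c : ℝ) * x + d| : ℝ) : ℂ)⁻¹ * H (((a : ℝ) * x + b) / (c * x + d)),
    ?_, ?_⟩
  · have hlin : ∀ u v : ℤ, ContDiff ℝ ∞ fun x : ℝ => (u : ℝ) * x + v := fun u v => by fun_prop
    refine ContDiffOn.mul ?_ ?_
    · refine ContDiffOn.inv ?_ ?_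
      · refine Complex.ofRealCLM.contDiff.comp_contDiffOn fun x hx => ?_
        exact ((hlin c d).contDiffAt.abs (key x hx).1).contDiffWithinAt
      · intro x hx
        simpa using (key x hx).1
    · exact hH.comp ((hlin a b).contDiffOn.div (hlin c d).contDiffOn fun x hx => (key x hx).1)
        fun x hx => (key x hx).2
  · intro x hx
    have hx' : ((a * x + b) / (c * x + d) : ℚ) ∉ S := by
      intro hs
      refine (key x ?_).2 ⟨_, hs, ?_⟩
      · rintro ⟨y, hy, hyx⟩
        have : y = x := Rat.cast_injective hyx
        exact hx (this ▸ hy)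
      · push_cast; rfl
    have := hS _ hx'
    push_cast at this
    have habs : ((|(c : ℚ) * x + d| : ℚ) : ℂ) = ((|(c : ℝ) * x + d| : ℝ) : ℂ) := by
      rw [← Complex.ofReal_ratCast]
      push_cast
      rfl
    simp only [QuantumModular.act, ← ha, ← hb, ← hc, ← hd]
    rw [← this, habs]

theorem act_sum {ι : Type*} (s : Finset ι) (M : Matrix (Fin 2) (Fin 2) ℤ) (w : ι → ℂ)
    (F : ι → ℚ → ℂ) (x : ℚ) :
    act M (fun y => ∑ i ∈ s, w i * F i y) x = ∑ i ∈ s, w i * act M (F i) x := by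
  simp only [act, Finset.mul_sum]
  exact Finset.sum_congr rfl fun i _ => by ring

/-! ### Reduction to generators -/

theorem coe_det_ne_zero {N : ℕ} (γ : Gamma0 N) : (γ : SL(2, ℤ)).1.det ≠ 0 := by
  rw [(γ : SL(2, ℤ)).2]; exact one_ne_zero

theorem act_sub_const_mul (M : Matrix (Fin 2) (Fin 2) ℤ) (u : ℂ) (F G : ℚ → ℂ) (x : ℚ) :
    act M (fun y => F y - u * G y) x = act M F x - u * act M G x := by
  simp only [act]
  ring

theorem act_one (f : ℚ → ℂ) : act 1 f = f := by
  funext x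
  simp [act]

/-- The matrices for which the modular relation holds up to a smooth function form a subgroup,
because `f - f|γδ = (f - f|δ) + (f - f|γ)|δ` away from finitely many points. -/
def relationSubgroup {N : ℕ} (χ : Gamma0 N →* Circle) (f : ℚ → ℂ) : Subgroup (Gamma0 N) where
  carrier := {γ | ExtendsSmoothly fun x => f x - (χ γ : ℂ)⁻¹ * act (γ : SL(2, ℤ)).1 f x}
  one_mem' := by
    refine ExtendsSmoothly.zero.congr (Eventually.of_forall fun x => ?_)
    simp [act_one]
  mul_mem' := by
    intro γ δ hγ hδ
    refine (hδ.add ((hγ.act (coe_det_ne_zero δ)).const_mul (χ δ : ℂ)⁻¹)).congr ?_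
    filter_upwards [act_mul (γ : SL(2, ℤ)).1 (coe_det_ne_zero δ) f] with x hx
    rw [act_sub_const_mul, ← hx, Subgroup.coe_mul, Matrix.SpecialLinearGroup.coe_mul, map_mul,
      Circle.coe_mul, mul_inv]
    ring
  inv_mem' := by
    intro γ hγ
    have hd := coe_det_ne_zero γ⁻¹
    refine ((hγ.act hd).const_mul (-(χ γ : ℂ))).congr ?_
    filter_upwards [act_mul (γ : SL(2, ℤ)).1 hd f] with x hx
    have hone : (γ : SL(2, ℤ)).1 * ((γ⁻¹ : Gamma0 N) : SL(2, ℤ)).1 = 1 := by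
      rw [← Matrix.SpecialLinearGroup.coe_mul, ← Subgroup.coe_mul]; simp
    rw [hone, act_one] at hx
    have hne : (χ γ : ℂ) ≠ 0 := Circle.coe_ne_zero _
    rw [act_sub_const_mul, ← hx, map_inv, Circle.coe_inv, inv_inv]
    field_simp
    ring

theorem isQuantumModularForm_one_iff {N : ℕ} (χ : Gamma0 N →* Circle) (f : ℚ → ℂ) :
    IsQuantumModularForm N 1 χ f ↔ ∀ γ, γ ∈ relationSubgroup χ f :=
  forall_congr' fun γ => by
    simp only [slash_one_eq]
    rfl

/-! ### Generation of `Γ₀(2)` and the values of its multiplier system -/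

theorem exists_gamma0_two {a b k d : ℤ} (h : a * d - b * (2 * k) = 1) :
    ∃ γ : Gamma0 2, (γ : SL(2, ℤ)).1 = !![a, b; 2 * k, d] :=
  ⟨⟨⟨!![a, b; 2 * k, d], by rw [Matrix.det_fin_two_of, h]⟩, Gamma0_mem.mpr (by
    change (((2 * k : ℤ)) : ZMod 2) = 0
    rw [ZMod.intCast_zmod_eq_zero_iff_dvd]
    exact ⟨k, rfl⟩)⟩, rfl⟩

theorem exists_eq_of_gamma0_two (γ : Gamma0 2) : ∃ a b k d : ℤ,
    (γ : SL(2, ℤ)).1 = !![a, b; 2 * k, d] ∧ a * d - b * (2 * k) = 1 := by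
  have hc : (2 : ℤ) ∣ (γ : SL(2, ℤ)).1 1 0 := by
    have := Gamma0_mem.mp γ.2
    rwa [ZMod.intCast_zmod_eq_zero_iff_dvd] at this
  obtain ⟨k, hk⟩ := hc
  have hdet := (γ : SL(2, ℤ)).2
  rw [Matrix.det_fin_two, hk] at hdet
  refine ⟨_, _, k, _, ?_, hdet⟩
  rw [← hk]
  exact Matrix.eta_fin_two _

theorem gamma0_ext {γ δ : Gamma0 2} (h : (γ : SL(2, ℤ)).1 = (δ : SL(2, ℤ)).1) : γ = δ :=
  Subtype.ext (Subtype.ext h)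

theorem coe_mul_T (γ : Gamma0 2) {a b c d : ℤ} (h : (γ : SL(2, ℤ)).1 = !![a, b; c, d]) :
    ((γ * T : Gamma0 2) : SL(2, ℤ)).1 = !![a, b + a; c, d + c] := by
  rw [Subgroup.coe_mul, Matrix.SpecialLinearGroup.coe_mul, h]
  simp [T, matT, add_comm]

theorem coe_mul_R (γ : Gamma0 2) {a b c d : ℤ} (h : (γ : SL(2, ℤ)).1 = !![a, b; c, d]) :
    ((γ * R : Gamma0 2) : SL(2, ℤ)).1 = !![a + 2 * b, b; c + 2 * d, d] := by
  rw [Subgroup.coe_mul, Matrix.SpecialLinearGroup.coe_mul, h]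
  simp [R, matR, mul_comm]

/-- The matrix `δ` is `γ * T ^ n`. -/
theorem exists_coe_eq_mul_T_pow {P : Gamma0 2 → Prop} (hT : ∀ γ, P (γ * T) ↔ P γ)
    {γ : Gamma0 2} {a b c d : ℤ} (h : (γ : SL(2, ℤ)).1 = !![a, b; c, d]) (n : ℤ) :
    ∃ δ : Gamma0 2, (δ : SL(2, ℤ)).1 = !![a, b + n * a; c, d + n * c] ∧ (P δ ↔ P γ) := by
  induction n with
  | zero => exact ⟨γ, by simpa using h, Iff.rfl⟩
  | succ n ih =>
    obtain ⟨δ, hδ, hP⟩ := ih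
    exact ⟨δ * T, by rw [coe_mul_T δ hδ]; congr! 3 <;> ring_nf, (hT δ).trans hP⟩
  | pred n ih =>
    obtain ⟨δ, hδ, hP⟩ := ih
    have hmul : δ = δ * T⁻¹ * T := by group
    refine ⟨δ * T⁻¹, ?_, by rw [← hT, ← hmul, hP]⟩
    obtain ⟨a', b', k', d', h', -⟩ := exists_eq_of_gamma0_two (δ * T⁻¹)
    have h2 := coe_mul_T _ h'
    rw [← hmul, hδ] at h2
    simp only [EmbeddingLike.apply_eq_iff_eq, Matrix.vecCons_inj, and_true] at h2
    obtain ⟨⟨h00, h01⟩, h10, h11⟩ := h2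
    have e1 : b' = b + (-n - 1) * a := by linear_combination -h01 + h00
    have e2 : d' = d + (-n - 1) * c := by linear_combination -h11 + h10
    rw [h', ← h00, ← h10, e1, e2]

/-- The matrix `δ` is `γ * R ^ n`. -/
theorem exists_coe_eq_mul_R_pow {P : Gamma0 2 → Prop} (hR : ∀ γ, P (γ * R) ↔ P γ)
    {γ : Gamma0 2} {a b c d : ℤ} (h : (γ : SL(2, ℤ)).1 = !![a, b; c, d]) (n : ℤ) :
    ∃ δ : Gamma0 2, (δ : SL(2, ℤ)).1 = !![a + n * (2 * b), b; c + n * (2 * d), d] ∧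
      (P δ ↔ P γ) := by
  induction n with
  | zero => exact ⟨γ, by simpa using h, Iff.rfl⟩
  | succ n ih =>
    obtain ⟨δ, hδ, hP⟩ := ih
    exact ⟨δ * R, by rw [coe_mul_R δ hδ]; congr! 3 <;> ring_nf, (hR δ).trans hP⟩
  | pred n ih =>
    obtain ⟨δ, hδ, hP⟩ := ih
    have hmul : δ = δ * R⁻¹ * R := by group
    refine ⟨δ * R⁻¹, ?_, by rw [← hR, ← hmul, hP]⟩
    obtain ⟨a', b', k', d', h', -⟩ := exists_eq_of_gamma0_two (δ * R⁻¹)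
    have h2 := coe_mul_R _ h'
    rw [← hmul, hδ] at h2
    simp only [EmbeddingLike.apply_eq_iff_eq, Matrix.vecCons_inj, and_true] at h2
    obtain ⟨⟨h00, h01⟩, h10, h11⟩ := h2
    have e1 : a' = a + (-n - 1) * (2 * b) := by linear_combination -h00 + 2 * h01
    have e2 : 2 * k' = c + (-n - 1) * (2 * d) := by linear_combination -h10 + 2 * h11
    rw [h', ← h01, ← h11, e1, e2]

/-- A property of matrices in `Γ₀(2)` that holds for `1` and does not change under right
multiplication by `T` and by `R` holds everywhere: the Euclidean algorithm on the bottom row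
lowers `|c|` to `0`. -/
theorem gamma0_two_induction {P : Gamma0 2 → Prop} (one : P 1) (hT : ∀ γ, P (γ * T) ↔ P γ)
    (hR : ∀ γ, P (γ * R) ↔ P γ) (γ : Gamma0 2) : P γ := by
  have upper : ∀ (γ : Gamma0 2) (b : ℤ), (γ : SL(2, ℤ)).1 = !![1, b; 0, 1] → P γ := by
    intro γ b h
    obtain ⟨δ, hδ, hP⟩ := exists_coe_eq_mul_T_pow hT h (-b)
    have : δ = 1 := gamma0_ext (by
      rw [hδ, Subgroup.coe_one, Matrix.SpecialLinearGroup.coe_one, Matrix.one_fin_two]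
      simp)
    rw [← hP, this]
    exact one
  obtain ⟨n, hn⟩ : ∃ n, n = ((γ : SL(2, ℤ)).1 1 0).natAbs := ⟨_, rfl⟩
  induction n using Nat.strong_induction_on generalizing γ with
  | _ n ih =>
  obtain ⟨a, b, k, d, h, hdet⟩ := exists_eq_of_gamma0_two γ
  have hn' : n = (2 * k).natAbs := by rw [hn, h]; rfl
  by_cases hk : k = 0
  · subst hk
    have had : a * d = 1 := by linarith
    rcases Int.eq_one_or_neg_one_of_mul_eq_one' had with ⟨rfl, rfl⟩ | ⟨rfl, rfl⟩
    · exact upper γ b (by simpa using h)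
    · -- `R T⁻¹ R T⁻¹ = -1`, so `γ R T⁻¹ R` has diagonal `(1, 1)`
      obtain ⟨δ, hδ, hP⟩ := exists_coe_eq_mul_T_pow hT (coe_mul_R γ h) (-1)
      rw [← hR, ← hP, ← hR]
      refine upper _ (1 - b) ?_
      rw [coe_mul_R δ hδ]
      congr! 3 <;> ring_nf
  · have hd : d % 2 = 1 := by
      rcases Int.emod_two_eq_zero_or_one d with h0 | h1
      · obtain ⟨e, rfl⟩ := Int.dvd_of_emod_eq_zero h0
        have : 2 * (a * e - b * k) = 1 := by linarith
        omega
      · exact h1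
    -- `T`-steps bring `d` to `0 < r < |c|`, as `r` is odd; then `R`-steps bring `c` to `[-r, r)`
    obtain ⟨δ, hδ, hP⟩ := exists_coe_eq_mul_T_pow hT h (-(d / (2 * k)))
    obtain ⟨r, hr⟩ : ∃ r, r = d % (2 * k) := ⟨_, rfl⟩
    have hdr : d + -(d / (2 * k)) * (2 * k) = r := by
      rw [hr, Int.emod_def]; ring
    have hr0 : 0 ≤ r := hr ▸ Int.emod_nonneg _ (by omega)
    have hr1 : r < |2 * k| := hr ▸ Int.emod_lt_abs _ (by omega)
    have hrodd : r % 2 = 1 := by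
      rw [← hdr, show d + -(d / (2 * k)) * (2 * k) = d + 2 * (-(d / (2 * k)) * k) by ring]
      omega
    rw [hdr] at hδ
    obtain ⟨ε, hε, hP'⟩ := exists_coe_eq_mul_R_pow hR hδ (-((2 * k + r) / (2 * r)))
    rw [← hP, ← hP']
    refine ih _ ?_ ε rfl
    rw [hε, hn']
    change (2 * k + -((2 * k + r) / (2 * r)) * (2 * r)).natAbs < _
    have h1 := Int.emod_nonneg (2 * k + r) (b := 2 * r) (by omega)
    have h2 := Int.emod_lt_of_pos (2 * k + r) (b := 2 * r) (by omega)
    rw [Int.emod_def] at h1 h2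
    have h3 : -((2 * k + r) / (2 * r)) * (2 * r) = -(2 * r * ((2 * k + r) / (2 * r))) := by ring
    rw [h3]
    generalize 2 * r * ((2 * k + r) / (2 * r)) = s at *
    rw [Int.abs_eq_natAbs] at hr1
    omega

/-- It suffices to check the modular relation on the generators `T` and `R` of `Γ₀(2)`. -/
theorem isQuantumModularForm_of_generators (χ : Gamma0 2 →* Circle) (f : ℚ → ℂ)
    (hT : T ∈ relationSubgroup χ f) (hR : R ∈ relationSubgroup χ f) :
    IsQuantumModularForm 2 1 χ f :=
  (isQuantumModularForm_one_iff χ f).mpr <|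
    gamma0_two_induction (one_mem _) (fun _ => Subgroup.mul_mem_cancel_right _ hT)
      fun _ => Subgroup.mul_mem_cancel_right _ hR

/-- The root of unity `e^{2πin/48}`. -/
noncomputable def e48 (n : ℤ) : ℂ := Complex.exp (2 * Real.pi * Complex.I * (n / 48))

theorem e48_add (m n : ℤ) : e48 (m + n) = e48 m * e48 n := by
  rw [e48, e48, e48, ← Complex.exp_add]
  congr 1
  push_cast
  ring

theorem e48_zero : e48 0 = 1 := by simp [e48]

theorem e48_ne_zero (n : ℤ) : e48 n ≠ 0 := Complex.exp_ne_zero _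

theorem e48_zpow (m n : ℤ) : e48 m ^ n = e48 (m * n) := by
  rw [e48, e48, ← Complex.exp_int_mul]
  congr 1
  push_cast
  ring

theorem e48_pow (m : ℤ) (n : ℕ) : e48 m ^ n = e48 (m * n) := by
  rw [← zpow_natCast, e48_zpow]

theorem e48_eq_of_dvd {m n : ℤ} (h : 48 ∣ m - n) : e48 m = e48 n := by
  obtain ⟨k, hk⟩ := h
  obtain rfl : m = n + 48 * k := by linarith
  have : e48 (48 * k) = 1 := by
    rw [e48, Complex.exp_eq_one_iff]
    exact ⟨k, by push_cast; ring⟩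
  rw [e48_add, this, mul_one]

theorem zeta24_eq : zeta24 = e48 2 := by
  rw [zeta24, e48]
  congr 1
  push_cast
  ring

theorem neg_one_eq : (-1 : ℂ) = e48 24 := by
  rw [e48, ← Complex.exp_pi_mul_I]
  congr 1
  push_cast
  ring

/-- Twice the logarithm, in units of `2πi/24`, of the multiplier of `η(2τ)/η(τ)`. It comes from
Petersson's formula for the multiplier of `η`; the Jacobi symbols contribute `(2/d)`, which is the
term `3(d² - 1)`. -/
def phase (M : Matrix (Fin 2) (Fin 2) ℤ) : ℤ :=
  M 0 1 * M 1 1 * (M 1 0 ^ 2 + 2) + M 1 0 * (2 * M 1 1 - M 0 0) + 3 * (M 1 1 ^ 2 - 1)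

theorem dvd_of_mod_three_of_mod_four {n : ℤ} (h3 : (n : ZMod 3) = 0) (h4 : (n : ZMod 4) = 0) :
    12 ∣ n := by
  rw [ZMod.intCast_zmod_eq_zero_iff_dvd] at h3 h4
  omega

theorem phase_mul_T (γ : Gamma0 2) :
    48 ∣ phase ((γ * T : Gamma0 2) : SL(2, ℤ)).1 - (phase (γ : SL(2, ℤ)).1 + 2) := by
  obtain ⟨a, b, k, d, h, hdet⟩ := exists_eq_of_gamma0_two γ
  rw [coe_mul_T γ h, h]
  have key : (12 : ℤ) ∣
      6 * k ^ 2 + 3 * k * d + 4 * b * k ^ 3 + 2 * b * k + 2 * a * k ^ 3 + a * k := by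
    apply dvd_of_mod_three_of_mod_four
    · push_cast
      generalize (a : ZMod 3) = a, (b : ZMod 3) = b, (k : ZMod 3) = k, (d : ZMod 3) = d
      revert a b k d
      decide
    · have h4 := congrArg (fun n : ℤ => (n : ZMod 4)) hdet
      push_cast at h4 ⊢
      generalize (a : ZMod 4) = a, (b : ZMod 4) = b, (k : ZMod 4) = k, (d : ZMod 4) = d at *
      revert a b k d
      decide
  obtain ⟨t, ht⟩ := key
  refine ⟨t, ?_⟩
  simp only [phase, Matrix.of_apply, Matrix.cons_val', Matrix.cons_val_zero, Matrix.cons_val_one,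
    Matrix.cons_val_fin_one]
  linear_combination 4 * ht + (2 + 4 * k ^ 2) * hdet

theorem phase_mul_R (γ : Gamma0 2) :
    48 ∣ phase ((γ * R : Gamma0 2) : SL(2, ℤ)).1 - (phase (γ : SL(2, ℤ)).1 + 2) := by
  obtain ⟨a, b, k, d, h, hdet⟩ := exists_eq_of_gamma0_two γ
  rw [coe_mul_R γ h, h]
  have key : (12 : ℤ) ∣ (d ^ 2 - 1) * (2 * b * k + b * d + 1) := by
    apply dvd_of_mod_three_of_mod_four
    · have h3 := congrArg (fun n : ℤ => (n : ZMod 3)) hdet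
      push_cast at h3 ⊢
      generalize (a : ZMod 3) = a, (b : ZMod 3) = b, (k : ZMod 3) = k, (d : ZMod 3) = d at *
      revert a b k d
      decide
    · have h4 := congrArg (fun n : ℤ => (n : ZMod 4)) hdet
      push_cast at h4 ⊢
      generalize (a : ZMod 4) = a, (b : ZMod 4) = b, (k : ZMod 4) = k, (d : ZMod 4) = d at *
      revert a b k d
      decide
  obtain ⟨t, ht⟩ := key
  refine ⟨t, ?_⟩
  simp only [phase, Matrix.of_apply, Matrix.cons_val', Matrix.cons_val_zero, Matrix.cons_val_one,
    Matrix.cons_val_fin_one]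
  linear_combination 4 * ht - 2 * hdet

/-- The multiplier system is given by a polynomial phase on all of `Γ₀(2)`. -/
theorem multiplier_eq (χ : Gamma0 2 →* Circle) (hχT : (χ T : ℂ) = zeta24)
    (hχR : (χ R : ℂ) = zeta24) (γ : Gamma0 2) :
    (χ γ : ℂ) = e48 (phase (γ : SL(2, ℤ)).1) := by
  induction γ using gamma0_two_induction with
  | one => simp [phase, e48_zero]
  | hT γ =>
    rw [map_mul, Circle.coe_mul, hχT, e48_eq_of_dvd (phase_mul_T γ), e48_add, zeta24_eq]
    exact mul_left_inj' (e48_ne_zero 2)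
  | hR γ =>
    rw [map_mul, Circle.coe_mul, hχR, e48_eq_of_dvd (phase_mul_R γ), e48_add, zeta24_eq]
    exact mul_left_inj' (e48_ne_zero 2)

/-! ### The Hecke operator as a sum over cosets -/

/-- The integer matrices of determinant `p` that define the Hecke operator, indexed by the points
of the projective line over `ZMod p`: `(p, 0; 0, 1)` at infinity and `(1, j; 0, p)` at `j`. -/
def heckeMatrix (p : ℕ) : Option (ZMod p) → Matrix (Fin 2) (Fin 2) ℤ
  | none => !![p, 0; 0, 1]
  | some j => !![1, j.val; 0, p]

/-- The coefficients of the Hecke operator, as exponents of `e^{2πi/48}`. The one at infinity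
encodes the sign `(-1)^((p² - 1)/24)`. -/
def heckeExponent (p : ℕ) : Option (ZMod p) → ℤ
  | none => (p : ℤ) ^ 2 - 1
  | some j => -(2 * (p : ℤ) * j.val)

theorem heckeMatrix_det_ne_zero {p : ℕ} [NeZero p] (i : Option (ZMod p)) :
    (heckeMatrix p i).det ≠ 0 := by
  cases i <;> simp [heckeMatrix, NeZero.ne p]

theorem exists_sq_eq {p : ℕ} (hp : p.Prime) (hp5 : 5 ≤ p) : ∃ m : ℕ, p ^ 2 = 24 * m + 1 := by
  have h2 : p % 2 ≠ 0 := fun h => by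
    have := (Nat.prime_dvd_prime_iff_eq Nat.prime_two hp).mp (Nat.dvd_of_mod_eq_zero h)
    omega
  have h3 : p % 3 ≠ 0 := fun h => by
    have := (Nat.prime_dvd_prime_iff_eq Nat.prime_three hp).mp (Nat.dvd_of_mod_eq_zero h)
    omega
  have h24 : p ^ 2 % 24 = 1 := by
    have : p % 24 = 1 ∨ p % 24 = 5 ∨ p % 24 = 7 ∨ p % 24 = 11 ∨ p % 24 = 13 ∨ p % 24 = 17 ∨
        p % 24 = 19 ∨ p % 24 = 23 := by omega
    rcases this with h | h | h | h | h | h | h | h <;> simp [Nat.pow_mod, h]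
  exact ⟨p ^ 2 / 24, by omega⟩

theorem sum_range_eq_sum_zmod {p : ℕ} [NeZero p] (F : ℕ → ℂ) :
    ∑ j ∈ Finset.range p, F j = ∑ j : ZMod p, F j.val := by
  refine Finset.sum_bij' (fun j _ => (j : ZMod p)) (fun j _ => j.val) ?_ ?_ ?_ ?_ ?_
  · simp
  · intro j _; simpa using ZMod.val_lt j
  · intro j hj; exact ZMod.val_cast_of_lt (by simpa using hj)
  · intro j _; exact ZMod.natCast_zmod_val j
  · intro j hj; rw [ZMod.val_cast_of_lt (by simpa using hj)]

theorem hecke_eq_sum {p : ℕ} (hp : p.Prime) (hp5 : 5 ≤ p) [NeZero p] (f : ℚ → ℂ) :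
    hecke p f = fun x => ∑ i, e48 (heckeExponent p i) * act (heckeMatrix p i) f x := by
  obtain ⟨m, hm⟩ := exists_sq_eq hp hp5
  funext x
  rw [Fintype.sum_option, hecke, sum_range_eq_sum_zmod, Finset.mul_sum]
  congr 1
  · have hsign : (-1 : ℂ) ^ ((p ^ 2 - 1) / 24) = e48 ((p : ℤ) ^ 2 - 1) := by
      have h1 : (p ^ 2 - 1) / 24 = m := by omega
      have h2 : (p : ℤ) ^ 2 - 1 = 24 * m := by
        rw [show (p : ℤ) ^ 2 = 24 * m + 1 by exact_mod_cast hm]; ring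
      rw [h1, h2, neg_one_eq, e48_pow]
    simp [hsign, heckeExponent, heckeMatrix, act]
  · refine Finset.sum_congr rfl fun j _ => ?_
    rw [zeta24_eq, e48_zpow,
      show (2 : ℤ) * -((p : ℤ) * (j.val : ℤ)) = -(2 * (p : ℤ) * j.val) by ring]
    simp [heckeExponent, heckeMatrix, act]
    ring

/-- If right multiplication by `B` permutes the cosets of the Hecke matrices, in a way compatible
with the coefficients and the multiplier, then the Hecke operator preserves the modular relation
at `B`. -/
theorem mem_relationSubgroup_hecke {χ : Gamma0 2 →* Circle} (hχT : (χ T : ℂ) = zeta24)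
    (hχR : (χ R : ℂ) = zeta24) {f : ℚ → ℂ} (hf : IsQuantumModularForm 2 1 χ f)
    {p : ℕ} (hp : p.Prime) (hp5 : 5 ≤ p) [NeZero p] {B : Gamma0 2} (hχB : (χ B : ℂ) = zeta24)
    {σ : Option (ZMod p) → Option (ZMod p)} (hσ : σ.Injective)
    (h : ∀ i, ∃ γ : Gamma0 2,
      heckeMatrix p i * (B : SL(2, ℤ)).1 = (γ : SL(2, ℤ)).1 * heckeMatrix p (σ i) ∧
      48 ∣ heckeExponent p i - 2 * p + phase (γ : SL(2, ℤ)).1 - heckeExponent p (σ i)) :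
    B ∈ relationSubgroup (χ ^ p) (hecke p f) := by
  rw [isQuantumModularForm_one_iff] at hf
  have hterm : ∀ i ∈ Finset.univ, ExtendsSmoothly fun x =>
      e48 (heckeExponent p (σ i)) * act (heckeMatrix p (σ i)) f x -
        e48 (-(2 * p)) * (e48 (heckeExponent p i) *
          act (B : SL(2, ℤ)).1 (act (heckeMatrix p i) f) x) := by
    intro i _
    obtain ⟨γ, hγ, hdvd⟩ := h i
    have hdet := heckeMatrix_det_ne_zero (σ i)
    refine (((hf γ).act hdet).const_mul (e48 (heckeExponent p (σ i)))).congr ?_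
    filter_upwards [act_mul (γ : SL(2, ℤ)).1 hdet f,
      act_mul (heckeMatrix p i) (coe_det_ne_zero B) f] with x hx hx'
    have he := e48_eq_of_dvd hdvd
    rw [sub_eq_add_neg, e48_add, e48_add, ← multiplier_eq χ hχT hχR γ] at he
    have hne : (χ γ : ℂ) ≠ 0 := Circle.coe_ne_zero _
    rw [act_sub_const_mul, ← hx, ← hx', hγ, ← he]
    field_simp
  have hB : ((((χ ^ p : Gamma0 2 →* Circle) B : Circle) : ℂ))⁻¹ = e48 (-(2 * p)) := by
    rw [MonoidHom.pow_apply, Circle.coe_pow, hχB, zeta24_eq, e48_pow, ← zpow_neg_one, e48_zpow]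
    congr 1
    ring
  refine (ExtendsSmoothly.sum Finset.univ hterm).congr (Eventually.of_forall fun x => ?_)
  have hperm := (Equiv.ofBijective σ (Finite.injective_iff_bijective.mp hσ)).sum_comp fun i =>
    e48 (heckeExponent p i) * act (heckeMatrix p i) f x
  simp only [Equiv.ofBijective_apply] at hperm
  beta_reduce
  rw [Finset.sum_sub_distrib, hperm, ← Finset.mul_sum, hB, hecke_eq_sum hp hp5, act_sum]

/-! ### The two generators -/

theorem T_mem_relationSubgroup_hecke {χ : Gamma0 2 →* Circle} (hχT : (χ T : ℂ) = zeta24)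
    (hχR : (χ R : ℂ) = zeta24) {f : ℚ → ℂ} (hf : IsQuantumModularForm 2 1 χ f)
    {p : ℕ} (hp : p.Prime) (hp5 : 5 ≤ p) : T ∈ relationSubgroup (χ ^ p) (hecke p f) := by
  have : NeZero p := ⟨hp.ne_zero⟩
  obtain ⟨m, hm⟩ := exists_sq_eq hp hp5
  have hm' : (p : ℤ) ^ 2 = 24 * m + 1 := by exact_mod_cast hm
  refine mem_relationSubgroup_hecke hχT hχR hf hp hp5 hχT (σ := Option.map (· + 1))
    (Option.map_injective (add_left_injective 1)) ?_
  have hT : (T : SL(2, ℤ)).1 = !![1, 1; 0, 1] := rfl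
  rintro (_ | j)
  · obtain ⟨γ, hγ⟩ := exists_gamma0_two (a := 1) (b := p) (k := 0) (d := 1) (by ring)
    refine ⟨γ, ?_, ?_⟩
    · rw [hγ, hT]; simp [heckeMatrix]
    · rw [hγ]; simp [heckeExponent, phase]; ring_nf; simp
  · obtain ⟨j', hj'⟩ : ∃ j' : ℤ, j' = (j.val : ℤ) := ⟨_, rfl⟩
    obtain ⟨k, hk⟩ : ∃ k : ℤ, k = ((j + 1).val : ℤ) := ⟨_, rfl⟩
    have hdvd : (p : ℤ) ∣ j' + 1 - k := by
      rw [← ZMod.intCast_zmod_eq_zero_iff_dvd, hj', hk]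
      simp
    obtain ⟨t, ht⟩ := hdvd
    obtain ⟨γ, hγ⟩ := exists_gamma0_two (a := 1) (b := t) (k := 0) (d := 1) (by ring)
    refine ⟨γ, ?_, ?_⟩
    · rw [hγ, hT]
      simp [heckeMatrix, ← hj', ← hk]
      linear_combination ht
    · rw [hγ]
      refine ⟨-(t * m), ?_⟩
      simp [heckeExponent, phase, ← hj', ← hk]
      linear_combination -2 * (p : ℤ) * ht - 2 * t * hm'

/-- The action of `R` from the right on the cosets, `j ↦ j / (1 + 2j)` on the projective line over
`ZMod p`. -/
def cosetMapR (p : ℕ) [Fact p.Prime] : Option (ZMod p) → Option (ZMod p)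
  | none => some 2⁻¹
  | some j => if 1 + 2 * j = 0 then none else some (j / (1 + 2 * j))

theorem cosetMapR_injective {p : ℕ} [Fact p.Prime] (h2 : (2 : ZMod p) ≠ 0) :
    (cosetMapR p).Injective := by
  have hinf : ∀ j : ZMod p, 1 + 2 * j ≠ 0 → 2⁻¹ ≠ j / (1 + 2 * j) := by
    intro j hj h
    rw [eq_div_iff hj, mul_add, inv_mul_cancel_left₀ h2, mul_one] at h
    exact inv_ne_zero h2 (by linear_combination h)
  rintro (_ | i) (_ | j) h
  · rfl
  · simp only [cosetMapR] at h
    split_ifs at h with hj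
    exact absurd (Option.some_injective _ h) (hinf j hj)
  · simp only [cosetMapR] at h
    split_ifs at h with hi
    exact absurd (Option.some_injective _ h.symm) (hinf i hi)
  · simp only [cosetMapR] at h
    split_ifs at h with hi hj hj
    · have : (2 : ZMod p) * (i - j) = 0 := by linear_combination hi - hj
      rw [sub_eq_zero.mp ((mul_eq_zero.mp this).resolve_left h2)]
    · have h' := Option.some_injective _ h
      rw [div_eq_div_iff hi hj] at h'
      congr 1
      linear_combination h'

theorem R_mem_relationSubgroup_hecke {χ : Gamma0 2 →* Circle} (hχT : (χ T : ℂ) = zeta24)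
    (hχR : (χ R : ℂ) = zeta24) {f : ℚ → ℂ} (hf : IsQuantumModularForm 2 1 χ f)
    {p : ℕ} (hp : p.Prime) (hp5 : 5 ≤ p) : R ∈ relationSubgroup (χ ^ p) (hecke p f) := by
  have : NeZero p := ⟨hp.ne_zero⟩
  have : Fact p.Prime := ⟨hp⟩
  obtain ⟨m, hm⟩ := exists_sq_eq hp hp5
  have hm' : (p : ℤ) ^ 2 = 24 * m + 1 := by exact_mod_cast hm
  have h2 : (2 : ZMod p) ≠ 0 := by
    intro h
    have h' : ((2 : ℕ) : ZMod p) = 0 := by exact_mod_cast h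
    rw [ZMod.natCast_eq_zero_iff] at h'
    have := Nat.le_of_dvd two_pos h'
    omega
  refine mem_relationSubgroup_hecke hχT hχR hf hp hp5 hχR (cosetMapR_injective h2) ?_
  have hR : (R : SL(2, ℤ)).1 = !![1, 0; 2, 1] := rfl
  rintro (_ | j)
  -- the point at infinity goes to `1/2`: `(p, 0; 0, 1) R = (p, -k; 2, d) (1, k; 0, p)`
  · obtain ⟨k, hk⟩ : ∃ k : ℤ, k = ((2⁻¹ : ZMod p).val : ℤ) := ⟨_, rfl⟩
    have hdvd : (p : ℤ) ∣ 1 - 2 * k := by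
      rw [← ZMod.intCast_zmod_eq_zero_iff_dvd, hk]
      simp [h2]
    obtain ⟨d, hd⟩ := hdvd
    obtain ⟨γ, hγ⟩ := exists_gamma0_two (a := p) (b := -k) (k := 1) (d := d)
      (by linear_combination -hd)
    refine ⟨γ, ?_, ?_⟩
    · rw [hγ, hR]
      simp [heckeMatrix, cosetMapR, ← hk]
      constructor
      · ring
      · linear_combination hd
    · rw [hγ]
      obtain ⟨e, rfl⟩ : Odd d := by
        rw [← Int.not_even_iff_odd]
        rintro ⟨e, rfl⟩
        have : 2 * (p * e + k) = 1 := by linear_combination -hd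
        omega
      obtain ⟨r, hr⟩ : Even ((p : ℤ) + 1) := by
        rw [Int.even_add_one, ← Int.not_odd_iff_even, not_not]
        exact_mod_cast hp.odd_of_ne_two (by omega)
      obtain ⟨s, hs⟩ := Int.even_mul_succ_self e
      refine ⟨r * s - m * e, ?_⟩
      simp [heckeExponent, phase, cosetMapR, ← hk]
      linear_combination (3 * (2 * e + 1) - p) * hd - 2 * e * hm' +
        12 * (e * (e + 1)) * hr + 24 * r * hs
  · obtain ⟨j', hj'⟩ : ∃ j' : ℤ, j' = (j.val : ℤ) := ⟨_, rfl⟩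
    have hjz : (j' : ZMod p) = j := by simp [hj']
    by_cases hj : 1 + 2 * j = 0
    -- the point `-1/2` goes to infinity: `(1, j; 0, p) R = (t, j; 2, p) (p, 0; 0, 1)`
    · have hdvd : (p : ℤ) ∣ 1 + 2 * j' := by
        rw [← ZMod.intCast_zmod_eq_zero_iff_dvd]
        push_cast
        rw [hjz, hj]
      obtain ⟨t, ht⟩ := hdvd
      obtain ⟨γ, hγ⟩ := exists_gamma0_two (a := t) (b := j') (k := 1) (d := p)
        (by linear_combination -ht)
      refine ⟨γ, ?_, ?_⟩
      · rw [hγ, hR]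
        simp [heckeMatrix, cosetMapR, hj, ← hj']
        constructor
        · linear_combination ht
        · ring
      · rw [hγ]
        refine ⟨(t + 1) * m, ?_⟩
        simp [heckeExponent, phase, cosetMapR, hj, ← hj']
        linear_combination 2 * p * ht + (2 * t + 2) * hm'
    -- otherwise `(1, j; 0, p) R = (1 + 2j, b; 2p, 1 - 2k) (1, k; 0, p)`
    · obtain ⟨k, hk⟩ : ∃ k : ℤ, k = ((j / (1 + 2 * j)).val : ℤ) := ⟨_, rfl⟩
      have hkz : (k : ZMod p) = j / (1 + 2 * j) := by simp [hk]
      have hdvd : (p : ℤ) ∣ j' - k - 2 * j' * k := by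
        rw [← ZMod.intCast_zmod_eq_zero_iff_dvd]
        have hjk : (k : ZMod p) * (1 + 2 * j) = j := by rw [hkz, div_mul_cancel₀ _ hj]
        push_cast
        rw [hjz]
        linear_combination -hjk
      obtain ⟨b, hb⟩ := hdvd
      obtain ⟨γ, hγ⟩ := exists_gamma0_two (a := 1 + 2 * j') (b := b) (k := p) (d := 1 - 2 * k)
        (by linear_combination 2 * hb)
      refine ⟨γ, ?_, ?_⟩
      · rw [hγ, hR]
        simp [heckeMatrix, cosetMapR, hj, ← hj', ← hk]
        refine ⟨⟨by ring, ?_⟩, by ring, by ring⟩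
        linear_combination hb
      · rw [hγ]
        have h8 : (8 : ℤ) ∣ b * (1 - 2 * k) - p * (j' + k) + 2 * k * (k - 1) := by
          -- multiplied by `p`, with `p b` substituted, this is `4 (1 + j) k (k - 1)` modulo `8`
          have hp8 : (p : ZMod 8) * p = 1 := by
            have h := congrArg (fun n : ℤ => (n : ZMod 8)) hm'
            push_cast at h
            rw [← sq, h, show (24 : ZMod 8) = 0 from rfl, zero_mul, zero_add]
          have hb8 : (b : ZMod 8) = p * (j' - k - 2 * j' * k) := by
            have h := congrArg (fun n : ℤ => (n : ZMod 8)) hb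
            push_cast at h
            rw [h, ← mul_assoc, hp8, one_mul]
          refine (ZMod.intCast_zmod_eq_zero_iff_dvd _ 8).mp ?_
          push_cast
          rw [hb8]
          clear * - hp8
          generalize (p : ZMod 8) = p, (j' : ZMod 8) = j', (k : ZMod 8) = k at *
          revert p j' k
          decide
        obtain ⟨t, ht⟩ := h8
        refine ⟨t + 2 * m * b * (1 - 2 * k), ?_⟩
        simp [heckeExponent, phase, cosetMapR, hj, ← hj', ← hk]
        linear_combination 6 * ht + 4 * b * (1 - 2 * k) * hm'

/-- The terms of the sum over `j` are permuted cyclically; the term `j = p` equals the term `j = 0`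
because `p² ≡ 1` modulo `24`. -/
theorem hecke_add_one {f : ℚ → ℂ} (hf : ∀ x, f (x + 1) = zeta24 * f x)
    {p : ℕ} (hp : p.Prime) (hp5 : 5 ≤ p) (x : ℚ) :
    hecke p f (x + 1) = zeta24 ^ p * hecke p f x := by
  obtain ⟨m, hm⟩ := exists_sq_eq hp hp5
  have hm' : (p : ℤ) ^ 2 = 24 * m + 1 := by exact_mod_cast hm
  have hp0 : (p : ℚ) ≠ 0 := by exact_mod_cast hp.ne_zero
  have hnat : ∀ (n : ℕ) (y : ℚ), f (y + n) = zeta24 ^ n * f y := by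
    intro n y
    induction n with
    | zero => simp
    | succ n ih => rw [Nat.cast_succ, ← add_assoc, hf, ih, pow_succ']; ring
  obtain ⟨F, hF⟩ : ∃ F : ℕ → ℂ,
      F = fun j : ℕ => zeta24 ^ (-((p : ℤ) * (j : ℤ))) * f ((x + (j : ℚ)) / (p : ℚ)) := ⟨_, rfl⟩
  have hstep : ∀ j : ℕ, zeta24 ^ (-((p : ℤ) * (j : ℤ))) * f ((x + 1 + (j : ℚ)) / (p : ℚ)) =
      zeta24 ^ p * F (j + 1) := by
    intro j
    simp only [hF]
    rw [← mul_assoc, zeta24_eq, e48_zpow, e48_pow, e48_zpow, ← e48_add]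
    congr 2
    · push_cast; ring
    · push_cast; ring
  have hend : F p = F 0 := by
    simp only [hF]
    rw [add_div, div_self hp0, hf, ← mul_assoc, zeta24_eq, e48_zpow, ← e48_add]
    rw [e48_eq_of_dvd (n := 0) ⟨-m, by linear_combination -2 * hm'⟩, e48_zero]
    simp
  have hcyc : ∑ j ∈ Finset.range p, F (j + 1) = ∑ j ∈ Finset.range p, F j := by
    have := Finset.sum_range_succ F p
    rw [Finset.sum_range_succ' F p, hend] at this
    exact add_right_cancel this
  rw [hecke, hecke, Finset.sum_congr rfl fun j _ => hstep j, ← Finset.mul_sum, hcyc, hF,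
    mul_add, mul_one, hnat]
  ring

end QuantumModular

theorem theorem2 (χ : CongruenceSubgroup.Gamma0 2 →* Circle)
    (hχT : (χ QuantumModular.T : ℂ) = QuantumModular.zeta24)
    (hχR : (χ QuantumModular.R : ℂ) = QuantumModular.zeta24)
    (f : ℚ → ℂ) (hf : QuantumModular.IsQuantumModularForm 2 1 χ f)
    (p : ℕ) (hp : p.Prime) (hp5 : 5 ≤ p) (hp757 : p ≤ 757) :
    QuantumModular.IsQuantumModularForm 2 1 (χ ^ p) (QuantumModular.hecke p f) ∧
    ((∀ x : ℚ, f (x + 1) = QuantumModular.zeta24 * f x) →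
      (∀ x : ℚ, QuantumModular.hecke p f (x + 1) =
        QuantumModular.zeta24 ^ p * QuantumModular.hecke p f x) ∧
      QuantumModular.ExtendsSmoothly (fun x : ℚ =>
        1 / ((|2 * x + 1| : ℚ) : ℂ) * QuantumModular.hecke p f (x / (2 * x + 1)) -
          QuantumModular.zeta24 ^ p * QuantumModular.hecke p f x)) := by
  have hg := QuantumModular.isQuantumModularForm_of_generators (χ ^ p) _
    (QuantumModular.T_mem_relationSubgroup_hecke hχT hχR hf hp hp5)
    (QuantumModular.R_mem_relationSubgroup_hecke hχT hχR hf hp hp5)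
  refine ⟨hg, fun hper => ⟨QuantumModular.hecke_add_one hper hp hp5, ?_⟩⟩
  refine ((hg QuantumModular.R).const_mul (-QuantumModular.zeta24 ^ p)).congr
    (Filter.Eventually.of_forall fun x => ?_)
  have hne : QuantumModular.zeta24 ^ p ≠ 0 := by
    rw [← hχR, ← Circle.coe_pow]
    exact Circle.coe_ne_zero _
  simp only [QuantumModular.slash_one_eq, MonoidHom.pow_apply, Circle.coe_pow, hχR]
  simp [QuantumModular.act, QuantumModular.R, QuantumModular.matR]
  field_simp
  ring
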